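/- Let $K$ be a field, let $0<a<b<c$ be integers with $\gcd(a,b,c)=1$, and let $I=(x^c,x^by^a,x^ay^b,y^c)$ be the corresponding symmetric monomial ideal in $S=K[x,y]$. Let $\mathfrak m=(x,y)$ and let $F(I)=\bigoplus_{j\ge 0} I^j/\mathfrak m I^j$ be the fiber cone of $I$, that is, $F(I)=R(I)/\mathfrak m R(I)$, where $R(I)=\bigoplus_{j\ge 0}I^j$ is the Rees algebra of $I$. Then $\operatorname{depth}F(I)>0$, where $\operatorname{depth} F(I)$ is the supremum of the lengths of the $F(I)$-regular sequences contained in the graded maximal ideal $\bigoplus_{j\ge 1} I^j/\mathfrak m I^j$ of $F(I)$. -/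

import Mathlib

/-- The extension `𝔪 R(I)` of an ideal `𝔪` of `S` to the Rees algebra `R(I) = ⨁ I ^ j`. -/
noncomputable def extendedIdeal {S : Type*} [CommRing S] (𝔪 I : Ideal S) : Ideal (reesAlgebra I) :=
  𝔪.map (algebraMap S (reesAlgebra I))

/-- The fiber cone `F(I) = R(I) / 𝔪 R(I)`, where `R(I) = ⨁ I ^ j` is the Rees algebra of `I`
(realised inside `S[t]` as the polynomials whose `j`-th coefficient lies in `I ^ j`). -/
abbrev FiberCone {S : Type*} [CommRing S] (𝔪 I : Ideal S) : Type _ :=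
  reesAlgebra I ⧸ extendedIdeal 𝔪 I

/-- The ideal `R(I)₊ = ⨁_{j ≥ 1} I ^ j` of the Rees algebra: the elements whose component in
degree `0` vanishes. -/
noncomputable def reesIrrelevant {S : Type*} [CommRing S] (I : Ideal S) : Ideal (reesAlgebra I) :=
  RingHom.ker ((Polynomial.constantCoeff (R := S)).comp (reesAlgebra I).val.toRingHom)

/-- The ideal `F(I)₊ = ⨁_{j ≥ 1} I ^ j / 𝔪 I ^ j` of the fiber cone, spanned by the elements of
positive degree. When `𝔪` is maximal it is the graded maximal ideal, as `F(I)₀ = S / 𝔪`. -/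
noncomputable def FiberCone.irrelevant {S : Type*} [CommRing S] (𝔪 I : Ideal S) : Ideal (FiberCone 𝔪 I) :=
  (reesIrrelevant I).map (Ideal.Quotient.mk (extendedIdeal 𝔪 I))

/-- The depth of `M` in the ideal `J`: the supremum of the lengths of the `M`-regular sequences
with entries in `J`. -/
noncomputable def idealDepth {R : Type*} [CommRing R] (J : Ideal R)
    (M : Type*) [AddCommGroup M] [Module R M] : ℕ∞ :=
  ⨆ (rs : List R) (_ : (∀ r ∈ rs, r ∈ J) ∧ RingTheory.Sequence.IsRegular M rs), (rs.length : ℕ∞)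

/-- The depth of the fiber cone `F(I)`, as a graded ring with graded maximal ideal `F(I)₊`. -/
noncomputable def FiberCone.depth {S : Type*} [CommRing S] (𝔪 I : Ideal S) : ℕ∞ :=
  idealDepth (R := FiberCone 𝔪 I) (FiberCone.irrelevant 𝔪 I) (FiberCone 𝔪 I)

/-- The graded maximal ideal `(x, y)` of `K[x, y]`. -/
noncomputable def gradedMaximalIdeal (K : Type*) [Field K] : Ideal (MvPolynomial (Fin 2) K) :=
  Ideal.span {MvPolynomial.X 0, MvPolynomial.X 1}

/-- The ideal `(x ^ c, x ^ b y ^ a, x ^ a y ^ b, y ^ c)` of `K[x, y]`. -/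
noncomputable def symmetricIdeal (K : Type*) [Field K] (a b c : ℕ) :
    Ideal (MvPolynomial (Fin 2) K) :=
  Ideal.span {MvPolynomial.X 0 ^ c, MvPolynomial.X 0 ^ b * MvPolynomial.X 1 ^ a,
    MvPolynomial.X 0 ^ a * MvPolynomial.X 1 ^ b, MvPolynomial.X 1 ^ c}

/-!
Write `A = x ^ c`, `B = x ^ b * y ^ a`, `C = x ^ a * y ^ b`, `D = y ^ c` for the generators of `I`, and
`𝔪 = (x, y)`. Over a Noetherian ring, prime avoidance gives an ideal a nonzerodivisor as soon as no
nonzero element is annihilated by the ideal (`idealDepth_pos`). As `𝔪 R(I)` is graded with components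
`𝔪 * I ^ j` (`mem_extendedIdeal_iff`), positive depth of the fiber cone follows once every `u ∈ I ^ j`
with `I * u ⊆ 𝔪 * I ^ (j + 1)` lies in `𝔪 * I ^ j` (`FiberCone.depth_pos`). All these ideals are
monomial, so `u` may be taken to be a monomial, and membership becomes an inequality between exponents:
`u ∈ I ^ j` if `u` is divisible by a product of `j` generators, and `u ∈ 𝔪 * I ^ j` if it is a proper
multiple of one.

It remains to show that a minimal generator `u` of `I ^ j` stays minimal in `I ^ (j + 1)` after
multiplication by one of `A`, `B`, `C`, `D` (`DominatesProduct.strictly`). If `a + b = c`, all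
generators have the same degree and this is clear. If `a + b < c`, then `B C` properly divides `A D`, so
`u` does not involve both `A` and `D`; by symmetry let it omit `D`, and multiply by `B`. A product of
`j + 1` generators properly dividing `u B` cannot contain `B`, by cancellation, nor both `A` and `D`,
which could be traded for `B C`; so it is a product of `A`s and `C`s or of `C`s and `D`s, and the
convex position of `A`, `B`, `C`, or the degree in `y`, excludes these. If `c < a + b`, then `A D`
properly divides `B C`, so `u` omits `C`, say, and multiplication by `A` works in the same way.
-/

/-! ### The fiber cone of an ideal of a Noetherian ring -/

/-- The extended ideal `𝔪 R(I)` is graded, with component `𝔪 * I ^ j` in degree `j`. -/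
theorem mem_extendedIdeal_iff {S : Type*} [CommRing S] {𝔪 I : Ideal S} {f : reesAlgebra I} :
    f ∈ extendedIdeal 𝔪 I ↔ ∀ j, (f : Polynomial S).coeff j ∈ 𝔪 * I ^ j := by
  constructor
  · intro hf
    rw [extendedIdeal, Ideal.map] at hf
    induction hf using Submodule.span_induction with
    | mem x hx =>
      obtain ⟨r, hr, rfl⟩ := hx
      intro j
      rw [Subalgebra.coe_algebraMap, Polynomial.algebraMap_apply, Polynomial.coeff_C]
      split_ifs with h
      · simpa [h] using hr
      · exact zero_mem _
    | zero => simp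
    | add x y _ _ hx hy => intro j; simpa using add_mem (hx j) (hy j)
    | smul a x _ hx =>
      intro j
      rw [smul_eq_mul, Subalgebra.coe_mul, Polynomial.coeff_mul]
      refine sum_mem fun n hn => ?_
      rw [← Finset.HasAntidiagonal.mem_antidiagonal.mp hn, pow_add, mul_left_comm]
      exact Ideal.mul_mem_mul (a.2 n.1) (hx n.2)
  · intro hf
    -- Homogeneous elements of `𝔪 * I ^ j` lift; a polynomial is the sum of its monomials.
    have key (j : ℕ) {r : S} (hr : r ∈ 𝔪 * I ^ j) :
        ∃ g ∈ extendedIdeal 𝔪 I, (g : Polynomial S) = Polynomial.monomial j r := by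
      induction hr using Submodule.mul_induction_on' with
      | mem_mul_mem x hx y hy =>
        refine ⟨algebraMap S _ x * ⟨_, reesAlgebra.monomial_mem.mpr hy⟩,
          Ideal.mul_mem_right _ _ (Ideal.mem_map_of_mem _ hx), ?_⟩
        rw [Subalgebra.coe_mul, Subalgebra.coe_algebraMap, Polynomial.algebraMap_apply]
        exact Polynomial.C_mul_monomial
      | add x _ y _ hx hy =>
        obtain ⟨g, hg, hgx⟩ := hx
        obtain ⟨g', hg', hgy⟩ := hy
        exact ⟨g + g', add_mem hg hg', by simp [hgx, hgy]⟩
    choose g hg hgf using fun j => key j (hf j)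
    have hsum : f = ∑ j ∈ (f : Polynomial S).support, g j := by
      refine Subtype.ext ?_
      rw [AddSubmonoidClass.coe_finsetSum]
      simp_rw [hgf]
      exact (f : Polynomial S).as_sum_support
    rw [hsum]
    exact sum_mem fun j _ => hg j

theorem FiberCone.irrelevant_ne_top {S : Type*} [CommRing S] {𝔪 : Ideal S} (I : Ideal S)
    (h𝔪 : 𝔪 ≠ ⊤) : FiberCone.irrelevant 𝔪 I ≠ ⊤ := by
  intro h
  rw [Ideal.eq_top_iff_one, FiberCone.irrelevant,
    Ideal.mem_map_iff_of_surjective _ Ideal.Quotient.mk_surjective] at h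
  obtain ⟨w, hw, hw1⟩ := h
  rw [← map_one (Ideal.Quotient.mk _), Ideal.Quotient.mk_eq_mk_iff_sub_mem] at hw1
  have hw0 : (w : Polynomial S).coeff 0 = 0 := hw
  have := mem_extendedIdeal_iff.mp hw1 0
  apply h𝔪
  rw [Ideal.eq_top_iff_one]
  simpa [hw0] using this

/-- If no nonzero element is annihilated by `J`, then `J` contains a nonzerodivisor: otherwise prime
avoidance would put `J` inside a single associated prime, the annihilator of some element. -/
theorem idealDepth_pos {A : Type*} [CommRing A] [IsNoetherianRing A] {J : Ideal A} (hJ : J ≠ ⊤)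
    (h : ∀ x : A, (∀ r ∈ J, x * r = 0) → x = 0) : 0 < idealDepth J A := by
  obtain ⟨r, hr, hr'⟩ : ∃ r ∈ J, r ∈ nonZeroDivisors A := by
    by_contra! hno
    obtain ⟨-, x, hx, hx0⟩ := SetLike.lt_iff_le_and_exists.mp
      (Ideal.bot_lt_annihilator_of_disjoint_nonZeroDivisors (I := J) (Set.disjoint_left.mpr hno))
    exact hx0 ((Submodule.mem_bot A).mpr (h x fun r hr => Submodule.mem_annihilator.mp hx r hr))
  have hlen : (1 : ℕ∞) ≤ idealDepth J A := by
    refine le_iSup₂_of_le [r] ⟨by simpa using hr, ?_⟩ (by simp)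
    rw [RingTheory.Sequence.isRegular_iff, RingTheory.Sequence.isWeaklyRegular_cons_iff]
    refine ⟨⟨Module.Flat.isSMulRegular_of_nonZeroDivisors hr',
      RingTheory.Sequence.IsWeaklyRegular.nil _ _⟩, fun htop => hJ (top_le_iff.mp ?_)⟩
    rw [smul_eq_mul, Ideal.mul_top, Ideal.ofList_singleton] at htop
    exact htop.le.trans ((Ideal.span_singleton_le_iff_mem J).mpr hr)
  exact lt_of_lt_of_le zero_lt_one hlen

/-- The fiber cone has positive depth as soon as no nonzero homogeneous element is killed by its
degree one part `I / 𝔪 * I`. -/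
theorem FiberCone.depth_pos {S : Type*} [CommRing S] [IsNoetherianRing S] {𝔪 I : Ideal S}
    (h𝔪 : 𝔪 ≠ ⊤)
    (h : ∀ j, ∀ u ∈ I ^ j, (∀ v ∈ I, v * u ∈ 𝔪 * I ^ (j + 1)) → u ∈ 𝔪 * I ^ j) :
    0 < FiberCone.depth 𝔪 I := by
  refine idealDepth_pos (FiberCone.irrelevant_ne_top I h𝔪) fun x hx => ?_
  obtain ⟨f, rfl⟩ := Ideal.Quotient.mk_surjective x
  refine Ideal.Quotient.eq_zero_iff_mem.mpr
    (mem_extendedIdeal_iff.mpr fun j => h j _ (f.2 j) fun v hv => ?_)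
  let w : reesAlgebra I :=
    ⟨Polynomial.monomial 1 v, reesAlgebra.monomial_mem.mpr (by rwa [pow_one])⟩
  have hw : w ∈ reesIrrelevant I := by
    change (Polynomial.monomial 1 v).coeff 0 = 0
    simp [Polynomial.coeff_monomial]
  have hfw := hx _ (Ideal.mem_map_of_mem _ hw)
  rw [← map_mul, Ideal.Quotient.eq_zero_iff_mem, mem_extendedIdeal_iff] at hfw
  have := hfw (j + 1)
  rwa [Subalgebra.coe_mul, Polynomial.coeff_mul_monomial, mul_comm _ v] at this

/-! ### Divisibility between products of the four generators -/

/-- The monomial `x ^ p * y ^ q` is divisible by a product of `j` of the monomials `x ^ c`,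
`x ^ b * y ^ a`, `x ^ a * y ^ b`, `y ^ c`, taken with multiplicities `i`, `k`, `l`, `m`. -/
def DominatesProduct (a b c j p q : ℕ) : Prop :=
  ∃ i k l m, i + k + l + m = j ∧ i * c + k * b + l * a ≤ p ∧ k * a + l * b + m * c ≤ q

/-- The monomial `x ^ p * y ^ q` is a proper multiple of a product of `j` of the monomials `x ^ c`,
`x ^ b * y ^ a`, `x ^ a * y ^ b`, `y ^ c`; properness is read off the total degrees. -/
def StrictlyDominatesProduct (a b c j p q : ℕ) : Prop :=
  ∃ i k l m, i + k + l + m = j ∧ i * c + k * b + l * a ≤ p ∧ k * a + l * b + m * c ≤ q ∧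
    (i * c + k * b + l * a) + (k * a + l * b + m * c) < p + q

/-- The symmetry of the set of generators under exchanging `x` and `y`. -/
theorem StrictlyDominatesProduct.swap {a b c j p q : ℕ}
    (h : StrictlyDominatesProduct a b c j p q) : StrictlyDominatesProduct a b c j q p := by
  obtain ⟨i, k, l, m, h₁, h₂, h₃, h₄⟩ := h
  exact ⟨m, l, k, i, by omega, by omega, by omega, by omega⟩

/-- The case `a + b < c`, for a product `u` of generators not involving `D = y ^ c`: if `u B` is
not a minimal generator, with `B = x ^ b * y ^ a`, then neither is `u`. -/
theorem strictlyDominatesProduct_of_convex {a b c i k l j p q : ℕ} (hab : a < b)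
    (hbc : b < c) (h : a + b < c) (hj : j = i + k + l)
    (hp : p = i * c + k * b + l * a) (hq : q = k * a + l * b)
    (hB : StrictlyDominatesProduct a b c (j + 1) (p + b) (q + a)) :
    StrictlyDominatesProduct a b c j p q := by
  subst hj
  obtain ⟨α, β, γ, δ, hdeg, hx, hy, hlt⟩ := hB
  rcases β with _ | β
  · rcases α with _ | α
    · exfalso
      -- A product of copies of `C` and `D` has too large a degree in `y`.
      have h₁ : (i + k + l + 1) * b ≤ γ * b + δ * c := by
        rw [← hdeg]; nlinarith
      nlinarith [Nat.zero_le (i * b), Nat.mul_lt_mul_of_pos_left hab (Nat.succ_pos k)]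
    · rcases δ with _ | δ
      · exfalso
        -- The functional `b x + (c - a) y` takes the same value `b c` on `A` and `C` and the smaller
        -- value `b c - (b - a) (c - a - b)` on `B`, so trading `B`s for `A`s and `C`s raises it.
        obtain ⟨d, rfl⟩ : ∃ d, b = a + d := ⟨b - a, by omega⟩
        obtain ⟨e, rfl⟩ : ∃ e, c = a + (a + d) + e := ⟨c - a - (a + d), by omega⟩
        have hd : 0 < d := by omega
        have he : 0 < e := by omega
        have hα : α + γ = i + k + l := by omega
        have h₁ := Nat.mul_le_mul_right (a + d) hx
        have h₂ := Nat.mul_le_mul_right (a + d + e) hy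
        have h₃ : 0 < (k + 1) * (d * e) := by positivity
        zify at *
        have hα' : (α : ℤ) = i + k + l - γ := by linarith
        rw [hα', hp] at h₁
        rw [hq] at h₂
        linarith
      -- `B C` divides `A D`, so one may trade `A D` for `B C` and then cancel `B`.
      · exact ⟨α, 0, γ + 1, δ, by omega, by linarith, by linarith, by linarith⟩
  -- The dominated product contains `B`, which cancels.
  · exact ⟨α, β, γ, δ, by omega, by linarith, by linarith, by linarith⟩

/-- The case `c < a + b`, for a product `u` of generators not involving `C = x ^ a * y ^ b`: if `u A`
is not a minimal generator, with `A = x ^ c`, then neither is `u`. -/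
theorem strictlyDominatesProduct_of_concave {a b c i k m j p q : ℕ} (ha : 0 < a) (hab : a < b)
    (hbc : b < c) (h : c < a + b) (hj : j = i + k + m)
    (hp : p = i * c + k * b) (hq : q = k * a + m * c)
    (hA : StrictlyDominatesProduct a b c (j + 1) (p + c) q) :
    StrictlyDominatesProduct a b c j p q := by
  subst hj
  obtain ⟨α, β, γ, δ, hdeg, hx, hy, hlt⟩ := hA
  rcases α with _ | α
  · rcases β with _ | β
    · exfalso
      -- The bounds on the two degrees, weighted by `c - b` and `a`, eliminate `γ`; the remaining
      -- inequality contradicts `c - b < a` and `b (c - b) < a (c - a)`, which follow from `c < a + b`.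
      have hδ : (δ : ℤ) = i + k + m + 1 - γ := by
        zify at hdeg; linarith
      have h₁ : (((i + 1) * c + k * (c - a)) : ℤ) ≤ γ * (c - b) := by
        zify at hy hq
        rw [hδ, hq] at hy
        linarith
      have h₂ : (γ * a : ℤ) ≤ (i + 1) * c + k * b := by
        zify at hx hp
        linarith
      zify at *
      have h₃ := mul_le_mul_of_nonneg_right h₁ ha.le
      have h₄ := mul_le_mul_of_nonneg_right h₂ (by linarith : (0 : ℤ) ≤ c - b)
      have h₅ : (0 : ℤ) < (i + 1) * c * (a + b - c) :=
        mul_pos (mul_pos (by positivity) (by linarith)) (by linarith)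
      have h₆ : (0 : ℤ) ≤ k * ((b - a) * (a + b - c)) :=
        mul_nonneg (by positivity) (mul_nonneg (by linarith) (by linarith))
      linarith
    · rcases γ with _ | γ
      · exfalso
        zify at *
        have hδ : (δ : ℤ) = i + k + m - β := by linarith
        rw [hδ] at hy
        -- Here `β + 1 - k` copies of `B` replace `i + 1` copies of `A` and some of `D`. The two
        -- degrees force this number to be positive, and then `b ≤ c - a`.
        have h₁ : (i + 1) * (c : ℤ) ≤ (β + 1 - k) * (c - a) := by linarith
        have h₂ : (β + 1 - k) * (b : ℤ) ≤ (i + 1) * c := by linarith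
        have h₃ : (0 : ℤ) < (i + 1) * c := mul_pos (by positivity) (by linarith)
        have h₄ : (0 : ℤ) < β + 1 - k := by
          by_contra hs
          nlinarith
        nlinarith
      -- `A D` divides `B C`, so one may trade `B C` for `A D` and then cancel `A`.
      · exact ⟨0, β, γ, δ + 1, by omega, by linarith, by linarith, by linarith⟩
  -- The dominated product contains `A`, which cancels.
  · exact ⟨α, β, γ, δ, by omega, by linarith, by linarith, by linarith⟩

/-- If all four products of `x ^ p * y ^ q ∈ I ^ j` with a generator of `I` lie in
`𝔪 * I ^ (j + 1)`, then `x ^ p * y ^ q ∈ 𝔪 * I ^ j`. -/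
theorem DominatesProduct.strictly {a b c j p q : ℕ} (ha : 0 < a) (hab : a < b) (hbc : b < c)
    (h : DominatesProduct a b c j p q)
    (hA : StrictlyDominatesProduct a b c (j + 1) (p + c) q)
    (hB : StrictlyDominatesProduct a b c (j + 1) (p + b) (q + a))
    (hC : StrictlyDominatesProduct a b c (j + 1) (p + a) (q + b))
    (hD : StrictlyDominatesProduct a b c (j + 1) p (q + c)) :
    StrictlyDominatesProduct a b c j p q := by
  obtain ⟨i, k, l, m, rfl, hp, hq⟩ := h
  by_cases hlt : (i * c + k * b + l * a) + (k * a + l * b + m * c) < p + q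
  · exact ⟨i, k, l, m, rfl, hp, hq, hlt⟩
  obtain rfl : p = i * c + k * b + l * a := by omega
  obtain rfl : q = k * a + l * b + m * c := by omega
  rcases lt_trichotomy (a + b) c with h | h | h
  · rcases m with _ | m
    · exact strictlyDominatesProduct_of_convex (i := i) (k := k) (l := l) hab hbc h
        (by ring) (by ring) (by ring) hB
    · rcases i with _ | i
      · exact (strictlyDominatesProduct_of_convex (i := m + 1) (k := l) (l := k) hab hbc h
          (by ring) (by ring) (by ring) hC.swap).swap
      -- Both `A` and `D` occur, and `B C` divides `A D` properly.
      · exact ⟨i, k + 1, l + 1, m, by ring, by linarith, by linarith, by linarith⟩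
  -- All generators have degree `a + b`, so products of as many generators never divide properly.
  · exfalso
    obtain ⟨α, β, γ, δ, hdeg, -, -, hlt'⟩ := hA
    subst h
    have hmul : (α + β + γ + δ) * (a + b) = (i + k + l + m + 1) * (a + b) := by rw [hdeg]
    linarith
  · rcases l with _ | l
    · exact strictlyDominatesProduct_of_concave (i := i) (k := k) (m := m) ha hab hbc h
        (by ring) (by ring) (by ring) hA
    · rcases k with _ | k
      · exact (strictlyDominatesProduct_of_concave (i := m) (k := l + 1) (m := i) ha hab hbc h
          (by ring) (by ring) (by ring) hD.swap).swap
      -- Both `B` and `C` occur, and `A D` divides `B C` properly.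
      · exact ⟨i + 1, k, l, m + 1, by ring, by linarith, by linarith, by linarith⟩

/-! ### Powers of the symmetric ideal as monomial ideals -/

open MvPolynomial Pointwise

theorem span_monomial_mul_span_monomial {σ K : Type*} [Field K] (s t : Set (σ →₀ ℕ)) :
    Ideal.span ((fun u => monomial u (1 : K)) '' s) *
        Ideal.span ((fun u => monomial u (1 : K)) '' t) =
      Ideal.span ((fun u => monomial u (1 : K)) '' (s + t)) := by
  rw [Ideal.span_mul_span']
  congr 1
  ext f
  simp only [Set.mem_mul, Set.mem_image, Set.mem_add]
  constructor
  · rintro ⟨_, ⟨u, hu, rfl⟩, _, ⟨v, hv, rfl⟩, rfl⟩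
    exact ⟨u + v, ⟨u, hu, v, hv, rfl⟩, by simp [monomial_mul]⟩
  · rintro ⟨_, ⟨u, hu, v, hv, rfl⟩, rfl⟩
    exact ⟨_, ⟨u, hu, rfl⟩, _, ⟨v, hv, rfl⟩, by simp [monomial_mul]⟩

/-- The exponent vectors of the products of `j` generators of the symmetric ideal: the generators
`x ^ c`, `x ^ b * y ^ a`, `x ^ a * y ^ b`, `y ^ c` occur `i`, `k`, `l`, `m` times. -/
def productExponents (a b c j : ℕ) : Set (Fin 2 →₀ ℕ) :=
  {u | ∃ i k l m, i + k + l + m = j ∧ u 0 = i * c + k * b + l * a ∧ u 1 = k * a + l * b + m * c}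

/-- The exponent vector of the monomial `x ^ p * y ^ q`. -/
noncomputable def planeExponent (p q : ℕ) : Fin 2 →₀ ℕ := Finsupp.single 0 p + Finsupp.single 1 q

@[simp]
theorem planeExponent_zero (p q : ℕ) : planeExponent p q 0 = p := by simp [planeExponent]

@[simp]
theorem planeExponent_one (p q : ℕ) : planeExponent p q 1 = q := by simp [planeExponent]

theorem monomial_planeExponent (K : Type*) [Field K] (p q : ℕ) :
    monomial (planeExponent p q) (1 : K) = X 0 ^ p * X 1 ^ q := by
  simp [planeExponent, X_pow_eq_monomial, monomial_mul]

/-- The exponent vectors of the four generators `x ^ c`, `x ^ b * y ^ a`, `x ^ a * y ^ b`, `y ^ c`. -/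
noncomputable def symmetricExponents (a b c : ℕ) : Set (Fin 2 →₀ ℕ) :=
  {planeExponent c 0, planeExponent b a, planeExponent a b, planeExponent 0 c}

theorem symmetricIdeal_eq_span (K : Type*) [Field K] (a b c : ℕ) :
    symmetricIdeal K a b c =
      Ideal.span ((fun u => monomial u (1 : K)) '' symmetricExponents a b c) := by
  simp [symmetricIdeal, symmetricExponents, Set.image_insert_eq, monomial_planeExponent]

theorem gradedMaximalIdeal_eq_span (K : Type*) [Field K] :
    gradedMaximalIdeal K =
      Ideal.span ((fun u => monomial u (1 : K)) '' {planeExponent 1 0, planeExponent 0 1}) := by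
  simp [gradedMaximalIdeal, Set.image_insert_eq, monomial_planeExponent]

theorem productExponents_succ (a b c j : ℕ) :
    productExponents a b c (j + 1) = productExponents a b c j + symmetricExponents a b c := by
  ext u
  simp only [symmetricExponents, Set.mem_add, Set.mem_insert_iff, Set.mem_singleton_iff]
  constructor
  · rintro ⟨i, k, l, m, hdeg, h₀, h₁⟩
    rcases i with _ | i
    · rcases k with _ | k
      · rcases l with _ | l
        · rcases m with _ | m
          · omega
          · exact ⟨planeExponent 0 (m * c), ⟨0, 0, 0, m, by omega, by simp, by simp⟩, _,
              .inr (.inr (.inr rfl)), Eq.symm (by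
                rw [Finsupp.ext_iff, Fin.forall_fin_two]; simp [h₀, h₁]; ring)⟩
        · exact ⟨planeExponent (l * a) (l * b + m * c), ⟨0, 0, l, m, by omega, by simp, by simp⟩, _,
            .inr (.inr (.inl rfl)), Eq.symm (by
              rw [Finsupp.ext_iff, Fin.forall_fin_two]; simp [h₀, h₁]; constructor <;> ring)⟩
      · exact ⟨planeExponent (k * b + l * a) (k * a + l * b + m * c),
          ⟨0, k, l, m, by omega, by simp, by simp⟩, _, .inr (.inl rfl), Eq.symm (by
            rw [Finsupp.ext_iff, Fin.forall_fin_two]; simp [h₀, h₁]; constructor <;> ring)⟩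
    · exact ⟨planeExponent (i * c + k * b + l * a) (k * a + l * b + m * c),
        ⟨i, k, l, m, by omega, by simp, by simp⟩, _, .inl rfl, Eq.symm (by
          rw [Finsupp.ext_iff, Fin.forall_fin_two]; simp [h₀, h₁]; ring)⟩
  · rintro ⟨v, ⟨i, k, l, m, hdeg, h₀, h₁⟩, w, rfl | rfl | rfl | rfl, rfl⟩
    · exact ⟨i + 1, k, l, m, by omega, by simp [h₀]; ring, by simp [h₁]⟩
    · exact ⟨i, k + 1, l, m, by omega, by simp [h₀]; ring, by simp [h₁]; ring⟩
    · exact ⟨i, k, l + 1, m, by omega, by simp [h₀]; ring, by simp [h₁]; ring⟩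
    · exact ⟨i, k, l, m + 1, by omega, by simp [h₀], by simp [h₁]; ring⟩

theorem symmetricIdeal_pow_eq_span (K : Type*) [Field K] (a b c j : ℕ) :
    symmetricIdeal K a b c ^ j =
      Ideal.span ((fun u => monomial u (1 : K)) '' productExponents a b c j) := by
  induction j with
  | zero =>
    have : productExponents a b c 0 = {0} := by
      ext u
      simp only [productExponents, Set.mem_ofPred_eq, Set.mem_singleton_iff, Finsupp.ext_iff,
        Fin.forall_fin_two, Finsupp.coe_zero, Pi.zero_apply]
      constructor
      · rintro ⟨i, k, l, m, hdeg, h₀, h₁⟩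
        obtain ⟨rfl, rfl, rfl, rfl⟩ : i = 0 ∧ k = 0 ∧ l = 0 ∧ m = 0 := by omega
        simpa using And.intro h₀ h₁
      · rintro ⟨h₀, h₁⟩
        exact ⟨0, 0, 0, 0, rfl, by simpa using h₀, by simpa using h₁⟩
    rw [this]
    simp
  | succ j ih =>
    rw [pow_succ, ih, symmetricIdeal_eq_span, span_monomial_mul_span_monomial,
      productExponents_succ]

theorem mem_symmetricIdeal_pow_iff {K : Type*} [Field K] {a b c j : ℕ}
    {f : MvPolynomial (Fin 2) K} :
    f ∈ symmetricIdeal K a b c ^ j ↔ ∀ u ∈ f.support, DominatesProduct a b c j (u 0) (u 1) := by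
  rw [symmetricIdeal_pow_eq_span, mem_ideal_span_monomial_image]
  refine forall₂_congr fun u _ => ⟨?_, ?_⟩
  · rintro ⟨v, ⟨i, k, l, m, hdeg, h₀, h₁⟩, hvu⟩
    exact ⟨i, k, l, m, hdeg, h₀ ▸ hvu 0, h₁ ▸ hvu 1⟩
  · rintro ⟨i, k, l, m, hdeg, h₀, h₁⟩
    exact ⟨planeExponent _ _, ⟨i, k, l, m, hdeg, planeExponent_zero _ _, planeExponent_one _ _⟩,
      Fin.forall_fin_two.mpr ⟨by simpa using h₀, by simpa using h₁⟩⟩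

theorem mem_gradedMaximalIdeal_mul_symmetricIdeal_pow_iff {K : Type*} [Field K] {a b c j : ℕ}
    {f : MvPolynomial (Fin 2) K} :
    f ∈ gradedMaximalIdeal K * symmetricIdeal K a b c ^ j ↔
      ∀ u ∈ f.support, StrictlyDominatesProduct a b c j (u 0) (u 1) := by
  rw [symmetricIdeal_pow_eq_span, gradedMaximalIdeal_eq_span, span_monomial_mul_span_monomial,
    mem_ideal_span_monomial_image]
  refine forall₂_congr fun u _ => ⟨?_, ?_⟩
  · rintro ⟨_, ⟨e, he, v, ⟨i, k, l, m, hdeg, h₀, h₁⟩, rfl⟩, hvu⟩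
    have hu₀ := hvu 0
    have hu₁ := hvu 1
    rcases he with rfl | rfl <;>
    · simp [h₀, h₁] at hu₀ hu₁
      exact ⟨i, k, l, m, hdeg, by omega, by omega, by omega⟩
  · rintro ⟨i, k, l, m, hdeg, h₀, h₁, hlt⟩
    have hv : planeExponent (i * c + k * b + l * a) (k * a + l * b + m * c) ∈
        productExponents a b c j :=
      ⟨i, k, l, m, hdeg, planeExponent_zero _ _, planeExponent_one _ _⟩
    rcases h₀.lt_or_eq with h | h
    · exact ⟨_, Set.add_mem_add (.inl rfl) hv,
        Fin.forall_fin_two.mpr ⟨by simp; omega, by simp; omega⟩⟩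
    · exact ⟨_, Set.add_mem_add (.inr rfl) hv,
        Fin.forall_fin_two.mpr ⟨by simp; omega, by simp; omega⟩⟩

theorem gradedMaximalIdeal_ne_top (K : Type*) [Field K] : gradedMaximalIdeal K ≠ ⊤ := by
  intro h
  have hle : gradedMaximalIdeal K ≤ RingHom.ker (constantCoeff (σ := Fin 2) (R := K)) := by
    rw [gradedMaximalIdeal, Ideal.span_le]
    rintro _ (rfl | rfl) <;> simp
  simpa using hle (h ▸ Submodule.mem_top : (1 : MvPolynomial (Fin 2) K) ∈ gradedMaximalIdeal K)

/-- A monomial of `f` times a generator of `I` is a monomial of the product, so no cancellation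
can hide it from the membership test for `𝔪 * I ^ (j + 1)`. -/
theorem StrictlyDominatesProduct.of_monomial_mul_mem {K : Type*} [Field K] {a b c j p q : ℕ}
    {f : MvPolynomial (Fin 2) K} {u : Fin 2 →₀ ℕ} (hu : u ∈ f.support)
    (hv : planeExponent p q ∈ symmetricExponents a b c)
    (hf : ∀ v ∈ symmetricIdeal K a b c,
      v * f ∈ gradedMaximalIdeal K * symmetricIdeal K a b c ^ (j + 1)) :
    StrictlyDominatesProduct a b c (j + 1) (u 0 + p) (u 1 + q) := by
  have hmem : monomial (planeExponent p q) (1 : K) ∈ symmetricIdeal K a b c := by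
    rw [symmetricIdeal_eq_span]
    exact Ideal.subset_span ⟨_, hv, rfl⟩
  have := mem_gradedMaximalIdeal_mul_symmetricIdeal_pow_iff.mp (hf _ hmem) (planeExponent p q + u)
    (by rw [mem_support_iff, coeff_monomial_mul, one_mul]; exact mem_support_iff.mp hu)
  simpa [add_comm] using this

theorem corollary3p3 (K : Type*) [Field K] (a b c : ℕ) (ha : 0 < a) (hab : a < b) (hbc : b < c)
    (hgcd : Nat.gcd (Nat.gcd a b) c = 1) :
    0 < FiberCone.depth (gradedMaximalIdeal K) (symmetricIdeal K a b c) := by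
  refine FiberCone.depth_pos (gradedMaximalIdeal_ne_top K) fun j f hf hIf => ?_
  rw [mem_gradedMaximalIdeal_mul_symmetricIdeal_pow_iff]
  intro u hu
  refine DominatesProduct.strictly ha hab hbc (mem_symmetricIdeal_pow_iff.mp hf u hu) ?_ ?_ ?_ ?_
  · exact .of_monomial_mul_mem hu (.inl rfl) hIf
  · exact .of_monomial_mul_mem hu (.inr (.inl rfl)) hIf
  · exact .of_monomial_mul_mem hu (.inr (.inr (.inl rfl))) hIf
  · exact .of_monomial_mul_mem hu (.inr (.inr (.inr rfl))) hIf
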